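/- Let $k$ be a field. A proalgebraic group over $k$ is an affine group scheme over $k$, identified with its functor of points on commutative $k$-algebras; closed subgroups are closed subgroup schemes. Let $G$ be a proalgebraic group over $k$ and let $H$ be a closed subgroup of finite index, that is, the right coset space $\Sigma=H\backslash G$ (the fpqc sheaf associated to $R\mapsto H(R)\backslash G(R)$) is a finite $k$-scheme. Let $T\colon\Sigma\to G$ be a section of the canonical map $\pi\colon G\to\Sigma$, i.e. a morphism of $k$-schemes with $\pi T=\mathrm{id}_\Sigma$. There is a unique right action of $G$ on $\Sigma$ for which $\pi$ is equivariant ($G$ acting on itself by right multiplication); let $\rho\colon G\to\mathrm{Aut}(\Sigma)^{\mathrm{op}}$ be the corresponding morphism, and let $\rho(G)$ be its scheme-theoretic image, i.e. the smallest closed subgroup of $\mathrm{Aut}(\Sigma)^{\mathrm{op}}$ through which $\rho$ factors; it is also the closed subscheme defined by the kernel of the dual map $\rho^*\colon k[\mathrm{Aut}(\Sigma)^{\mathrm{op}}]\to k[G]$. Let $H\wr\rho(G)=H^\Sigma\rtimes\rho(G)$ be the wreath product, where $H^\Sigma(R)=\mathrm{Hom}_R(\Sigma_R,H_R)$ with pointwise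 multiplication and $\rho(G)$ acts on $H^\Sigma$ from the left by $e(f)(s)=f(se)$. Then $H\wr\rho(G)$ is a proalgebraic group, and there is a closed embedding of proalgebraic groups (an isomorphism onto a closed subgroup) $\phi\colon G\to H\wr\rho(G)$ given by $\phi(g)=(f_g,\rho(g))$, where, for every $k$-algebra $R$ and $g\in G(R)$, the morphism $f_g\colon\Sigma_R\to H_R$ is given by $f_g(s)=T(s)\,g\,T(sg)^{-1}$ for every $R$-algebra $R'$ and $s\in\Sigma(R')$. -/

import Mathlib

open CategoryTheory Opposite
open scoped TensorProduct

universe u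

noncomputable section

namespace Proalg

variable {k : Type u} [Field k]

/-! ## Group functors and proalgebraic groups

All functors are covariant functors on the category `CommAlgCat k` of commutative `k`-algebras.
-/

/-- A group functor on `k`-algebras. -/
abbrev GroupFunctor (k : Type u) [Field k] := CommAlgCat.{u} k ⥤ GrpCat.{u}

/-- The functor of sets underlying a group functor. -/
abbrev GroupFunctor.sets (G : GroupFunctor k) : CommAlgCat.{u} k ⥤ Type u :=
  G ⋙ forget GrpCat.{u}

/-- A proalgebraic group over `k`, that is, an affine group scheme over `k`, is a group functor
whose functor of sets is isomorphic to `Hom_k(A, -)` for some commutative `k`-algebra `A`. -/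
def IsProalgebraic (G : GroupFunctor k) : Prop :=
  G.sets.IsCorepresentable

/-- Regular functions on a functor `X`: morphisms from `X` to the affine line, which is the functor
sending a `k`-algebra to its underlying set. If `X = Hom_k(A, -)`, these are the elements
of `A`. -/
abbrev Functions (X : CommAlgCat.{u} k ⥤ Type u) := X ⟶ forget (CommAlgCat.{u} k)

/-- The value in `R` of a regular function on the group functor `G` at a point of `G(R)`. -/
def GroupFunctor.value {G : GroupFunctor k} (F : Functions G.sets) {R : CommAlgCat.{u} k}
    (x : G.obj R) : R :=
  F.app R x

/-- A subgroup functor of a group functor. -/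
structure SubgroupFunctor (G : GroupFunctor k) where
  /-- The subgroup of `R`-points. -/
  obj : ∀ R : CommAlgCat.{u} k, Subgroup (G.obj R)
  map_mem : ∀ {R S : CommAlgCat.{u} k} (j : R ⟶ S) {x : G.obj R},
    x ∈ obj R → G.map j x ∈ obj S

namespace SubgroupFunctor

variable {G : GroupFunctor k}

/-- A subgroup functor as a group functor. -/
def toFunctor (H : SubgroupFunctor G) : GroupFunctor k where
  obj R := GrpCat.of (H.obj R)
  map j := GrpCat.ofHom
    (((G.map j).hom.comp (H.obj _).subtype).codRestrict (H.obj _) fun x => H.map_mem j x.2)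
  map_id R := by
    ext x : 2
    exact Subtype.ext (ConcreteCategory.congr_hom (G.map_id R) x.1)
  map_comp i j := by
    ext x : 2
    exact Subtype.ext (ConcreteCategory.congr_hom (G.map_comp i j) x.1)

/-- The inclusion of a subgroup functor. -/
def incl (H : SubgroupFunctor G) : H.toFunctor ⟶ G where
  app R := GrpCat.ofHom (H.obj R).subtype
  naturality R S j := by ext x; rfl

/-- A subgroup functor is closed if it is the zero locus of a set of regular functions. For a
proalgebraic group these are the closed subgroup schemes. -/
def IsClosed (H : SubgroupFunctor G) : Prop :=
  ∃ I : Set (Functions G.sets), ∀ (R : CommAlgCat.{u} k) (x : G.obj R),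
    x ∈ H.obj R ↔ ∀ F ∈ I, GroupFunctor.value F x = 0

end SubgroupFunctor

/-- A morphism of group functors is a closed embedding if it induces an isomorphism onto a closed
subgroup of the target. -/
def IsClosedEmbedding {G W : GroupFunctor k} (φ : G ⟶ W) : Prop :=
  ∃ Z : SubgroupFunctor W, Z.IsClosed ∧ ∃ e : G ≅ Z.toFunctor, e.hom ≫ Z.incl = φ

/-- The scheme theoretic image `φ(G)` of `φ : G ⟶ W`: the smallest closed subgroup of `W` through
which `φ` factors. -/
def image {G W : GroupFunctor k} (φ : G ⟶ W) : SubgroupFunctor W where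
  obj R := ⨅ (Z : SubgroupFunctor W) (_ : Z.IsClosed)
    (_ : ∀ (S : CommAlgCat.{u} k) (g : G.obj S), φ.app S g ∈ Z.obj S), Z.obj R
  map_mem j x hx := by
    simp only [Subgroup.mem_iInf] at hx ⊢
    exact fun Z hZ hφ => Z.map_mem j (hx Z hZ hφ)

/-- `Z` is the zero locus of the kernel of the dual map of `φ : G ⟶ W`, which sends a regular
function `F` on `W` to `F ∘ φ`. -/
def IsZeroLocusOfKernel {G W : GroupFunctor k} (φ : G ⟶ W) (Z : SubgroupFunctor W) : Prop :=
  ∀ (R : CommAlgCat.{u} k) (x : W.obj R), x ∈ Z.obj R ↔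
    ∀ F : Functions W.sets,
      (∀ (S : CommAlgCat.{u} k) (g : G.obj S), GroupFunctor.value F (φ.app S g) = 0) →
        GroupFunctor.value F x = 0

/-! ## Coset spaces -/

/-- The affine scheme `Spec B` as a functor of points. -/
abbrev Sp (B : CommAlgCat.{u} k) : CommAlgCat.{u} k ⥤ Type u :=
  coyoneda.obj (op B)

/-- The functor `R ↦ H(R)\G(R)`, the set of right cosets `H(R)g`. -/
def cosetFunctor {G : GroupFunctor k} (H : SubgroupFunctor G) : CommAlgCat.{u} k ⥤ Type u where
  obj R := Quotient (QuotientGroup.rightRel (H.obj R))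
  map {R S} j := TypeCat.ofHom <| Quotient.map (G.map j) fun x y h => by
    change QuotientGroup.rightRel _ _ _ at h
    change QuotientGroup.rightRel _ _ _
    rw [QuotientGroup.rightRel_apply] at h ⊢
    simpa using H.map_mem j h
  map_id R := by
    ext x
    induction x using Quotient.inductionOn with
    | h x => simp
  map_comp i j := by
    ext x
    induction x using Quotient.inductionOn with
    | h x => simp

/-- The projection `G(R) → H(R)\G(R)`. -/
def toCoset {G : GroupFunctor k} (H : SubgroupFunctor G) : G.sets ⟶ cosetFunctor H where
  app R := TypeCat.ofHom fun x => Quotient.mk (QuotientGroup.rightRel (H.obj R)) x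
  naturality R S j := by ext x; rfl

/-- The morphism `p` exhibits `Spec B` as the coset space `H\G`, that is, as the sheaf in the fpqc
topology associated to `R ↦ H(R)\G(R)`: it is injective and surjective locally for this topology.
(The functor `Spec B` is an fpqc sheaf. Coverings by a single faithfully flat map suffice, since
for proalgebraic `G` and closed `H` both functors turn finite products of algebras into
products of sets.) -/
structure IsCosetSpace {G : GroupFunctor k} (H : SubgroupFunctor G) {B : CommAlgCat.{u} k}
    (p : cosetFunctor H ⟶ Sp B) : Prop where
  locally_injective : ∀ (R : CommAlgCat.{u} k) (x y : (cosetFunctor H).obj R),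
    p.app R x = p.app R y → ∃ (S : CommAlgCat.{u} k) (j : R ⟶ S),
      j.hom.toRingHom.FaithfullyFlat ∧ (cosetFunctor H).map j x = (cosetFunctor H).map j y
  locally_surjective : ∀ (R : CommAlgCat.{u} k) (s : (Sp B).obj R),
    ∃ (S : CommAlgCat.{u} k) (j : R ⟶ S), j.hom.toRingHom.FaithfullyFlat ∧
      ∃ x : (cosetFunctor H).obj S, p.app S x = (Sp B).map j s

/-- The canonical map `G → H\G`, on `R`-points. -/
def proj {G : GroupFunctor k} {H : SubgroupFunctor G} {B : CommAlgCat.{u} k}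
    (p : cosetFunctor H ⟶ Sp B) {R : CommAlgCat.{u} k} (x : G.obj R) : B ⟶ R :=
  (toCoset H ≫ p).app R x

/-- The value `T(s) ∈ G(R)` at `s ∈ Σ(R)` of a morphism `T : Σ → G` for `Σ = Spec B`. -/
def pointOf {G : GroupFunctor k} {B : CommAlgCat.{u} k} (T : Sp B ⟶ G.sets)
    {R : CommAlgCat.{u} k} (s : B ⟶ R) : G.obj R :=
  T.app R s

/-! ## The automorphism group of `Σ = Spec B` -/

/-- The `k`-algebra `R ⊗ B`, the coordinate ring of `Σ_R` for `Σ = Spec B`. -/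
abbrev extend (B R : CommAlgCat.{u} k) : CommAlgCat.{u} k := CommAlgCat.of k (R ⊗[k] B)

/-- The map `R ⊗ B → S ⊗ B` induced by `R → S`. -/
def extendMap (B : CommAlgCat.{u} k) {R S : CommAlgCat.{u} k} (j : R ⟶ S) :
    extend B R ⟶ extend B S :=
  CommAlgCat.ofHom (Algebra.TensorProduct.map j.hom (AlgHom.id k B))

@[simp] lemma extendMap_tmul (B : CommAlgCat.{u} k) {R S : CommAlgCat.{u} k} (j : R ⟶ S)
    (r : R) (b : B) : (extendMap B j).hom (r ⊗ₜ[k] b) = j.hom r ⊗ₜ b := rfl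

lemma extendMap_id (B R : CommAlgCat.{u} k) : extendMap B (𝟙 R) = 𝟙 (extend B R) := by
  exact CommAlgCat.hom_ext (Algebra.TensorProduct.ext' fun _ _ => rfl)

lemma extendMap_comp (B : CommAlgCat.{u} k) {R S T : CommAlgCat.{u} k} (i : R ⟶ S) (j : S ⟶ T) :
    extendMap B (i ≫ j) = extendMap B i ≫ extendMap B j := by
  exact CommAlgCat.hom_ext (Algebra.TensorProduct.ext' fun _ _ => rfl)

/-- The base change along `R → S` of an endomorphism of the `R`-algebra `R ⊗ B`. -/
def baseChangeHom {B R S : CommAlgCat.{u} k} (j : R ⟶ S) (e : R ⊗[k] B →ₐ[R] R ⊗[k] B) :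
    S ⊗[k] B →ₐ[S] S ⊗[k] B :=
  Algebra.TensorProduct.lift (Algebra.ofId S (S ⊗[k] B))
    (((extendMap B j).hom.comp (e.restrictScalars k)).comp Algebra.TensorProduct.includeRight)
    fun _ _ => Commute.all _ _

@[simp] lemma baseChangeHom_tmul {B R S : CommAlgCat.{u} k} (j : R ⟶ S)
    (e : R ⊗[k] B →ₐ[R] R ⊗[k] B) (s : S) (b : B) :
    baseChangeHom j e (s ⊗ₜ[k] b) = (s ⊗ₜ[k] 1) * (extendMap B j).hom (e (1 ⊗ₜ[k] b)) := rfl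

lemma baseChangeHom_extendMap {B R S : CommAlgCat.{u} k} (j : R ⟶ S)
    (e : R ⊗[k] B →ₐ[R] R ⊗[k] B) (x : R ⊗[k] B) :
    baseChangeHom j e ((extendMap B j).hom x) = (extendMap B j).hom (e x) := by
  induction x using TensorProduct.induction_on with
  | zero => simp
  | tmul r b =>
    have h : (r ⊗ₜ[k] b : R ⊗[k] B) = r • ((1 : R) ⊗ₜ[k] b) := by
      rw [TensorProduct.smul_tmul', smul_eq_mul, mul_one]
    have h' : ∀ y : R ⊗[k] B, r • y = (r ⊗ₜ[k] 1) * y := fun y => by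
      rw [Algebra.smul_def]; rfl
    rw [extendMap_tmul, baseChangeHom_tmul, h, map_smul, h', map_mul]
    rfl
  | add x y hx hy => simp only [map_add, hx, hy]

lemma algHom_ext_tmul {B S : CommAlgCat.{u} k} {e e' : S ⊗[k] B →ₐ[S] S ⊗[k] B}
    (h : ∀ b : B, e (1 ⊗ₜ[k] b) = e' (1 ⊗ₜ[k] b)) : e = e' := by
  apply Algebra.TensorProduct.ext'
  intro s b
  have hs : (s ⊗ₜ[k] b : S ⊗[k] B) = s • ((1 : S) ⊗ₜ[k] b) := by
    rw [TensorProduct.smul_tmul', smul_eq_mul, mul_one]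
  rw [hs, map_smul, map_smul, h]

lemma extendMap_one_tmul {B R S : CommAlgCat.{u} k} (j : R ⟶ S) (b : B) :
    (1 : S) ⊗ₜ[k] b = (extendMap B j).hom ((1 : R) ⊗ₜ[k] b) := by
  rw [extendMap_tmul, map_one]

lemma baseChangeHom_id {B R S : CommAlgCat.{u} k} (j : R ⟶ S) :
    baseChangeHom j (AlgHom.id R (R ⊗[k] B)) = AlgHom.id S (S ⊗[k] B) :=
  algHom_ext_tmul fun b => by
    rw [extendMap_one_tmul j b, baseChangeHom_extendMap]; rfl

lemma baseChangeHom_comp {B R S : CommAlgCat.{u} k} (j : R ⟶ S)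
    (e e' : R ⊗[k] B →ₐ[R] R ⊗[k] B) :
    baseChangeHom j (e.comp e') = (baseChangeHom j e).comp (baseChangeHom j e') :=
  algHom_ext_tmul fun b => by
    rw [extendMap_one_tmul j b, AlgHom.comp_apply, baseChangeHom_extendMap,
      baseChangeHom_extendMap, baseChangeHom_extendMap]; rfl

/-- The base change of an automorphism of the `R`-algebra `R ⊗ B`. -/
def baseChangeAut (B : CommAlgCat.{u} k) {R S : CommAlgCat.{u} k} (j : R ⟶ S) :
    (R ⊗[k] B ≃ₐ[R] R ⊗[k] B) →* (S ⊗[k] B ≃ₐ[S] S ⊗[k] B) where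
  toFun e := AlgEquiv.ofAlgHom (baseChangeHom j e.toAlgHom) (baseChangeHom j e.symm.toAlgHom)
    (by rw [← baseChangeHom_comp, ← baseChangeHom_id j]; congr 1; ext; simp)
    (by rw [← baseChangeHom_comp, ← baseChangeHom_id j]; congr 1; ext; simp)
  map_one' := AlgEquiv.coe_toAlgHom_injective (baseChangeHom_id j)
  map_mul' e e' := AlgEquiv.coe_toAlgHom_injective (baseChangeHom_comp j e.toAlgHom e'.toAlgHom)

lemma baseChangeAut_extendMap {B R S : CommAlgCat.{u} k} (j : R ⟶ S)
    (e : R ⊗[k] B ≃ₐ[R] R ⊗[k] B) (x : R ⊗[k] B) :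
    baseChangeAut B j e ((extendMap B j).hom x) = (extendMap B j).hom (e x) :=
  baseChangeHom_extendMap j e.toAlgHom x

/-- The group functor `Aut(Σ)ᵒᵖ` for `Σ = Spec B`. An automorphism of the `R`-scheme `Σ_R` is given
by an automorphism of the `R`-algebra `R ⊗ B`; composition of automorphisms of `R ⊗ B` is the
opposite of composition of automorphisms of `Σ_R`. -/
def autOp (B : CommAlgCat.{u} k) : GroupFunctor k where
  obj R := GrpCat.of (R ⊗[k] B ≃ₐ[R] R ⊗[k] B)
  map j := GrpCat.ofHom (baseChangeAut B j)
  map_id R := by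
    ext e : 2
    apply AlgEquiv.coe_toAlgHom_injective
    refine algHom_ext_tmul fun b => ?_
    have := baseChangeAut_extendMap (𝟙 R) e (1 ⊗ₜ b)
    rw [extendMap_id] at this
    exact this
  map_comp i j := by
    ext e : 2
    apply AlgEquiv.coe_toAlgHom_injective
    refine algHom_ext_tmul fun b => ?_
    have h := baseChangeAut_extendMap (i ≫ j) e (1 ⊗ₜ b)
    rw [← extendMap_one_tmul, extendMap_comp] at h
    have h₁ := baseChangeAut_extendMap i e (1 ⊗ₜ b)
    have h₂ := baseChangeAut_extendMap j (baseChangeAut B i e) (1 ⊗ₜ b)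
    rw [← extendMap_one_tmul] at h₁ h₂
    refine h.trans (Eq.trans ?_ h₂.symm)
    rw [h₁]; rfl

/-- The homomorphism `R ⊗ B → S` given by a `k`-algebra map `j : R → S` and a point
`s ∈ Σ(S) = Hom_k(B, S)`. -/
def pointMap {B R S : CommAlgCat.{u} k} (j : R ⟶ S) (s : B ⟶ S) : extend B R ⟶ S :=
  CommAlgCat.ofHom (Algebra.TensorProduct.lift j.hom s.hom fun _ _ => Commute.all _ _)

/-- The right action of `e ∈ Aut(Σ)ᵒᵖ(R)` on the points `s ∈ Σ(S)`, for an `R`-algebra `S` with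
structure map `j`: the point `e(s)`, written `s e`. -/
def act {B R S : CommAlgCat.{u} k} (j : R ⟶ S) (s : B ⟶ S) (e : (autOp B).obj R) : B ⟶ S :=
  CommAlgCat.ofHom ((pointMap j s).hom.comp
    ((AlgHom.restrictScalars k (AlgEquiv.toAlgHom (show R ⊗[k] B ≃ₐ[R] R ⊗[k] B from e))).comp
      Algebra.TensorProduct.includeRight))

/-- A morphism `ρ : G ⟶ Aut(Σ)ᵒᵖ`, that is, a right action of `G` on `Σ = H\G`, is the natural one
if the canonical map `G → Σ` is equivariant for it and for right multiplication on `G`. -/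
def IsNaturalAction {G : GroupFunctor k} {H : SubgroupFunctor G} {B : CommAlgCat.{u} k}
    (p : cosetFunctor H ⟶ Sp B) (ρ : G ⟶ autOp B) : Prop :=
  ∀ {R S : CommAlgCat.{u} k} (j : R ⟶ S) (g : G.obj R) (x : G.obj S),
    act j (proj p x) (ρ.app R g) = proj p (x * G.map j g)

/-! ## Wreath products -/

/-- The group functor `A^Σ`, for `Σ = Spec B`. By Yoneda, the group `Hom(Σ_R, A_R)` of morphisms of
`R`-schemes with pointwise multiplication is the group `A(R ⊗ B)`. -/
def power (A : GroupFunctor k) (B : CommAlgCat.{u} k) : GroupFunctor k where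
  obj R := A.obj (extend B R)
  map j := A.map (extendMap B j)
  map_id R := by rw [extendMap_id, A.map_id]
  map_comp i j := by rw [extendMap_comp, A.map_comp]

/-- The value `f(s) ∈ A(S)` of `f ∈ A^Σ(R) = Hom(Σ_R, A_R)` at a point `s ∈ Σ(S)`, for an
`R`-algebra `S` with structure map `j`. -/
def eval {A : GroupFunctor k} {B R S : CommAlgCat.{u} k} (f : (power A B).obj R)
    (j : R ⟶ S) (s : B ⟶ S) : A.obj S :=
  A.map (pointMap j s) f

/-- An automorphism of the `R`-algebra `R ⊗ B` as a morphism of `k`-algebras. -/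
def autHom {B R : CommAlgCat.{u} k} (e : (autOp B).obj R) : extend B R ⟶ extend B R :=
  CommAlgCat.ofHom
    (AlgHom.restrictScalars k (AlgEquiv.toAlgHom (show R ⊗[k] B ≃ₐ[R] R ⊗[k] B from e)))

lemma autHom_one {B R : CommAlgCat.{u} k} : autHom (1 : (autOp B).obj R) = 𝟙 _ := rfl

lemma autHom_mul {B R : CommAlgCat.{u} k} (e e' : (autOp B).obj R) :
    autHom (e * e') = autHom e' ≫ autHom e := rfl

lemma extendMap_autHom {B R S : CommAlgCat.{u} k} (j : R ⟶ S) (e : (autOp B).obj R) :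
    autHom e ≫ extendMap B j = extendMap B j ≫ autHom ((autOp B).map j e) := by
  refine CommAlgCat.hom_ext (AlgHom.ext fun x : R ⊗[k] B => ?_)
  exact (baseChangeAut_extendMap j e x).symm

lemma map_map_apply (A : GroupFunctor k) {R S T : CommAlgCat.{u} k} (i : R ⟶ S) (j : S ⟶ T)
    (x : A.obj R) : A.map j (A.map i x) = A.map (i ≫ j) x :=
  (ConcreteCategory.congr_hom (A.map_comp i j) x).symm

/-- The left action of `Aut(Σ)ᵒᵖ(R)` on `A^Σ(R)`, which sends `f` to the composition of `f` with
the automorphism of `Σ_R`. -/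
def powerAction (A : GroupFunctor k) (B R : CommAlgCat.{u} k) :
    (autOp B).obj R →* MulAut ((power A B).obj R) where
  toFun e :=
    { toFun := A.map (autHom e)
      invFun := A.map (autHom e⁻¹)
      left_inv := fun f => by
        refine (map_map_apply A _ _ f).trans ?_
        rw [← autHom_mul, inv_mul_cancel, autHom_one, A.map_id]; rfl
      right_inv := fun f => by
        refine (map_map_apply A _ _ f).trans ?_
        rw [← autHom_mul, mul_inv_cancel, autHom_one, A.map_id]; rfl
      map_mul' := map_mul (A.map (autHom e)).hom }
  map_one' := by
    ext f
    change A.map (autHom 1) f = f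
    rw [autHom_one, A.map_id]; rfl
  map_mul' e e' := by
    ext f
    change A.map (autHom (e * e')) f = A.map (autHom e) (A.map (autHom e') f)
    rw [autHom_mul, A.map_comp]; rfl

/-- The defining formula `e(f)(s) = f(s e)` for the action of `Aut(Σ)ᵒᵖ` on `A^Σ`. -/
lemma eval_powerAction {A : GroupFunctor k} {B R S : CommAlgCat.{u} k} (e : (autOp B).obj R)
    (f : (power A B).obj R) (j : R ⟶ S) (s : B ⟶ S) :
    eval (powerAction A B R e f) j s = eval f j (act j s e) := by
  have h : autHom e ≫ pointMap j s = pointMap j (act j s e) := by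
    refine CommAlgCat.hom_ext (Algebra.TensorProduct.ext' fun r b => ?_)
    have h : (r ⊗ₜ[k] b : R ⊗[k] B) = (r ⊗ₜ[k] 1) * ((1 : R) ⊗ₜ[k] b) := by
      rw [Algebra.TensorProduct.tmul_mul_tmul, mul_one, one_mul]
    have h₁ : (autHom e).hom (r ⊗ₜ[k] (1 : B)) = r ⊗ₜ[k] (1 : B) :=
      AlgEquiv.commutes (show R ⊗[k] B ≃ₐ[R] R ⊗[k] B from e) r
    have h₂ : ∀ t : B ⟶ S, (pointMap j t).hom (r ⊗ₜ[k] (1 : B)) = j.hom r := fun t => by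
      simp [pointMap]
    have h₃ : (pointMap j (act j s e)).hom ((1 : R) ⊗ₜ[k] b) =
        (pointMap j s).hom ((autHom e).hom ((1 : R) ⊗ₜ[k] b)) := by
      rw [show (pointMap j (act j s e)).hom ((1 : R) ⊗ₜ[k] b) = (act j s e).hom b by
        simp [pointMap]]
      rfl
    rw [h, map_mul, map_mul, CommAlgCat.hom_comp, AlgHom.comp_apply, AlgHom.comp_apply, h₁,
      h₂, h₂, h₃]
  refine (map_map_apply A _ _ f).trans ?_
  rw [h]; rfl

/-- The wreath product `A ≀ Γ = A^Σ ⋊ Γ` with respect to a right action `σ` of the group functor `Γ`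
on `Σ = Spec B`. -/
def wreath (A : GroupFunctor k) {Γ : GroupFunctor k} {B : CommAlgCat.{u} k} (σ : Γ ⟶ autOp B) :
    GroupFunctor k where
  obj R := GrpCat.of
    ((power A B).obj R ⋊[(powerAction A B R).comp (σ.app R).hom] Γ.obj R)
  map {R S} j := GrpCat.ofHom <|
    SemidirectProduct.map ((power A B).map j).hom (Γ.map j).hom fun g => by
      ext f
      change A.map (extendMap B j) (A.map (autHom (σ.app R g)) f) =
        A.map (autHom (σ.app S (Γ.map j g))) (A.map (extendMap B j) f)
      refine (map_map_apply A _ _ f).trans (Eq.trans ?_ (map_map_apply A _ _ f).symm)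
      have h : σ.app S (Γ.map j g) = (autOp B).map j (σ.app R g) :=
        ConcreteCategory.congr_hom (σ.naturality j) g
      rw [extendMap_autHom, h]
  map_id R := by
    ext x : 2
    apply SemidirectProduct.ext
    · exact ConcreteCategory.congr_hom ((power A B).map_id R) x.left
    · exact ConcreteCategory.congr_hom (Γ.map_id R) x.right
  map_comp i j := by
    ext x : 2
    apply SemidirectProduct.ext
    · exact ConcreteCategory.congr_hom ((power A B).map_comp i j) x.left
    · exact ConcreteCategory.congr_hom (Γ.map_comp i j) x.right

/-- The component in `A^Σ(R)` of a point of the wreath product. -/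
def wreathLeft {A Γ : GroupFunctor k} {B : CommAlgCat.{u} k} {σ : Γ ⟶ autOp B}
    {R : CommAlgCat.{u} k} (w : (wreath A σ).obj R) : (power A B).obj R :=
  SemidirectProduct.left w

/-- The component in `Γ(R)` of a point of the wreath product. -/
def wreathRight {A Γ : GroupFunctor k} {B : CommAlgCat.{u} k} {σ : Γ ⟶ autOp B}
    {R : CommAlgCat.{u} k} (w : (wreath A σ).obj R) : Γ.obj R :=
  SemidirectProduct.right w

end Proalg

end

noncomputable section

namespace Proalg

variable {k : Type u} [Field k]

/-! ## Corepresentable functors -/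

/-! The embedding is recovered from one rational point. The base coset `s₀ = π(1)` is a `k`-point of
`Σ`, and `f_g(s₀) = T(s₀) g T(s₀g)⁻¹` can be solved for `g`: the morphism of schemes `(f, e) ↦
T(s₀)⁻¹ f(s₀) T(s₀e)` is a retraction of `φ`. The image of `φ` is therefore the locus `φ(r(w)) = w`,
which is closed because the wreath product is affine (`isClosedEmbedding_of_retraction`,
`wreathRetraction_toWreath`).

That `φ` is a homomorphism is the cocycle identity for `f_g` (`cocycle_mul`). The values of `f_g`
lie in `H` because `T(s)g` and `T(sg)` both lie over `sg` and the fibres of `π` are cosets of `H`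
(`proj_eq_iff`, by descent along a faithfully flat map). The section also forces the action, as `sg
= π(T(s)g)` (`exists_isNaturalAction`).

The rest is representability. Since `B` is finite over a field, `R ↦ X(R ⊗ B)` is affine for affine
`X`; hence so are `H^Σ` and `Aut(Σ)`. The zero locus of the kernel of `ρ*` is a subgroup because
tensor products over a field preserve injections (`value_mul_eq_zero`), so it is the image of `ρ`.
-/

lemma map_comp_apply' (X : CommAlgCat.{u} k ⥤ Type u) {R S T : CommAlgCat.{u} k} (i : R ⟶ S)
    (j : S ⟶ T) (x : X.obj R) : X.map j (X.map i x) = X.map (i ≫ j) x :=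
  (ConcreteCategory.congr_hom (X.map_comp i j) x).symm

lemma naturality_apply' {X Y : CommAlgCat.{u} k ⥤ Type u} (t : X ⟶ Y) {R S : CommAlgCat.{u} k}
    (j : R ⟶ S) (x : X.obj R) : t.app S (X.map j x) = Y.map j (t.app R x) :=
  ConcreteCategory.congr_hom (t.naturality j) x

/-- An element `x₀ ∈ X(D)` is universal if every element of every `X(R)` is the image of `x₀` under
a unique map `D → R`. -/
def IsUniversal (X : CommAlgCat.{u} k ⥤ Type u) (D : CommAlgCat.{u} k) (x₀ : X.obj D) : Prop :=
  ∀ (R : CommAlgCat.{u} k) (x : X.obj R), ∃! f : D ⟶ R, X.map f x₀ = x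

lemma IsUniversal.hom_ext {X : CommAlgCat.{u} k ⥤ Type u} {D : CommAlgCat.{u} k} {x₀ : X.obj D}
    (h : IsUniversal X D x₀) {R : CommAlgCat.{u} k} {f g : D ⟶ R}
    (hfg : X.map f x₀ = X.map g x₀) : f = g :=
  (h R (X.map g x₀)).unique hfg rfl

/-- Yoneda: the universal element is the image of the identity of `D`. Representability is handled
below by exhibiting such elements. -/
lemma isCorepresentable_iff {X : CommAlgCat.{u} k ⥤ Type u} :
    X.IsCorepresentable ↔ ∃ D x₀, IsUniversal X D x₀ := by
  constructor
  · rintro ⟨D, ⟨h⟩⟩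
    refine ⟨D, h.homEquiv (𝟙 D), fun R x => ?_⟩
    have key : ∀ f : D ⟶ R, X.map f (h.homEquiv (𝟙 D)) = h.homEquiv f :=
      fun f => (h.homEquiv_eq f).symm
    refine ⟨h.homEquiv.symm x, by simp [key], fun f hf => ?_⟩
    rw [← (key f).symm.trans hf, Equiv.symm_apply_apply]
  · rintro ⟨D, x₀, h⟩
    refine Functor.CorepresentableBy.isCorepresentable (X := D)
      { homEquiv := fun {R} => Equiv.ofBijective (fun f : D ⟶ R => X.map f x₀)
          ⟨fun f g hfg => h.hom_ext hfg, fun x => (h R x).exists⟩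
        homEquiv_comp := fun j f => (map_comp_apply' X f j x₀).symm }

/-- The regular function on `X` corresponding to an element of the representing algebra. -/
lemma IsUniversal.exists_function {X : CommAlgCat.{u} k ⥤ Type u} {D : CommAlgCat.{u} k}
    {x₀ : X.obj D} (h : IsUniversal X D x₀) (d : D) :
    ∃ F : Functions X, ∀ (R : CommAlgCat.{u} k) (f : D ⟶ R), F.app R (X.map f x₀) = f.hom d := by
  choose c hc using fun (R : CommAlgCat.{u} k) (x : X.obj R) => (h R x).exists
  have hc' : ∀ (R : CommAlgCat.{u} k) (f : D ⟶ R), c R (X.map f x₀) = f :=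
    fun R f => h.hom_ext (hc _ _)
  refine ⟨{ app := fun R => TypeCat.ofHom fun x => (c R x).hom d, naturality := ?_ }, ?_⟩
  · intro R S j
    ext x
    change (c S (X.map j x)).hom d = j.hom ((c R x).hom d)
    have : c S (X.map j x) = c R x ≫ j := by
      rw [← hc' S (c R x ≫ j), ← map_comp_apply', hc]
    rw [this]; rfl
  · intro R f
    change (c R (X.map f x₀)).hom d = f.hom d
    rw [hc']

/-- Regular functions separate the points of a corepresentable functor. -/
lemma eq_of_functions {X : CommAlgCat.{u} k ⥤ Type u} (hX : X.IsCorepresentable)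
    {R : CommAlgCat.{u} k} {x y : X.obj R} (hxy : ∀ F : Functions X, F.app R x = F.app R y) :
    x = y := by
  obtain ⟨D, x₀, h⟩ := isCorepresentable_iff.1 hX
  obtain ⟨f, rfl, -⟩ := h R x
  obtain ⟨g, rfl, -⟩ := h R y
  suffices f = g by rw [this]
  refine CommAlgCat.hom_ext (AlgHom.ext fun d : D => ?_)
  obtain ⟨F, hF⟩ := h.exists_function d
  exact (hF R f).symm.trans ((hxy F).trans (hF R g))

/-- Closed subfunctors of corepresentable functors are corepresentable. -/
lemma isCorepresentable_of_closed {X Y : CommAlgCat.{u} k ⥤ Type u} (hY : Y.IsCorepresentable)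
    (i : X ⟶ Y) (hi : ∀ R, Function.Injective (i.app R)) (I : Set (Functions Y))
    (hI : ∀ (R : CommAlgCat.{u} k) (y : Y.obj R),
      (∃ x, i.app R x = y) ↔ ∀ F ∈ I, (F.app R y : R) = 0) :
    X.IsCorepresentable := by
  obtain ⟨D, y₀, h⟩ := isCorepresentable_iff.1 hY
  -- `J` is generated by the equations evaluated at the universal point, so `D ⧸ J` should represent
  -- `X`.
  let J : Ideal D := Ideal.span {d | ∃ F ∈ I, (F.app D y₀ : D) = d}
  let q : D ⟶ CommAlgCat.of k (D ⧸ J) := CommAlgCat.ofHom (Ideal.Quotient.mkₐ k J)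
  have hq : ∀ F : Functions Y, ∀ {R : CommAlgCat.{u} k} (f : D ⟶ R),
      (F.app R (Y.map f y₀) : R) = f.hom (F.app D y₀ : D) := fun F R f => naturality_apply' F f y₀
  obtain ⟨x₁, hx₁⟩ := (hI _ (Y.map q y₀)).2 fun F hF => by
    rw [hq]
    exact Ideal.Quotient.eq_zero_iff_mem.2 (Ideal.subset_span ⟨F, hF, rfl⟩)
  refine isCorepresentable_iff.2 ⟨_, x₁, fun R x => ?_⟩
  obtain ⟨f, hf, -⟩ := h R (i.app R x)
  have hJ : ∀ d ∈ J, f.hom d = 0 := by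
    have : J ≤ RingHom.ker f.hom := by
      refine Ideal.span_le.2 ?_
      rintro _ ⟨F, hF, rfl⟩
      change f.hom _ = 0
      rw [← hq, hf]
      exact (hI R _).1 ⟨x, rfl⟩ F hF
    exact fun d hd => this hd
  have hiff : ∀ g : CommAlgCat.of k (D ⧸ J) ⟶ R, X.map g x₁ = x ↔ q ≫ g = f := by
    intro g
    rw [← (hi R).eq_iff, naturality_apply', hx₁, map_comp_apply', ← hf]
    exact ⟨fun h' => h.hom_ext h', fun h' => by rw [h']⟩
  refine ⟨CommAlgCat.ofHom (Ideal.Quotient.liftₐ J f.hom hJ), (hiff _).2 rfl, fun g hg => ?_⟩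
  refine CommAlgCat.hom_ext (Ideal.Quotient.algHom_ext k ?_)
  exact congrArg CommAlgCat.Hom.hom ((hiff g).1 hg)

/-- The structure map `R → R ⊗ B`. -/
def inl (B R : CommAlgCat.{u} k) : R ⟶ extend B R :=
  CommAlgCat.ofHom Algebra.TensorProduct.includeLeft

/-- The universal point of `Σ_R`, for `Σ = Spec B`. -/
def inr (B R : CommAlgCat.{u} k) : B ⟶ extend B R :=
  CommAlgCat.ofHom Algebra.TensorProduct.includeRight

/-! ### The coproduct `R ⊗ B` and the points of `Σ_R` -/

section extend

variable {B R S T : CommAlgCat.{u} k}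

lemma extend_hom_ext {f g : extend B R ⟶ S} (hl : inl B R ≫ f = inl B R ≫ g)
    (hr : inr B R ≫ f = inr B R ≫ g) : f = g :=
  CommAlgCat.hom_ext (Algebra.TensorProduct.ext (congrArg CommAlgCat.Hom.hom hl)
    (congrArg CommAlgCat.Hom.hom hr))

@[simp] lemma inl_pointMap (j : R ⟶ S) (s : B ⟶ S) : inl B R ≫ pointMap j s = j :=
  CommAlgCat.hom_ext (AlgHom.ext fun r => by simp [inl, pointMap])

@[simp] lemma inr_pointMap (j : R ⟶ S) (s : B ⟶ S) : inr B R ≫ pointMap j s = s :=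
  CommAlgCat.hom_ext (AlgHom.ext fun r => by simp [inr, pointMap])

@[simp] lemma inl_extendMap (j : R ⟶ S) : inl B R ≫ extendMap B j = j ≫ inl B S :=
  CommAlgCat.hom_ext (AlgHom.ext fun r => by simpa [inl] using extendMap_tmul B j r 1)

@[simp] lemma inr_extendMap (j : R ⟶ S) : inr B R ≫ extendMap B j = inr B S :=
  CommAlgCat.hom_ext (AlgHom.ext fun r => by simpa [inr] using extendMap_tmul B j 1 r)

lemma pointMap_comp (j : R ⟶ S) (s : B ⟶ S) (i : S ⟶ T) :
    pointMap j s ≫ i = pointMap (j ≫ i) (s ≫ i) :=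
  extend_hom_ext (by simp [← Category.assoc]) (by simp [← Category.assoc])

lemma extendMap_pointMap (i : R ⟶ S) (j : S ⟶ T) (s : B ⟶ T) :
    extendMap B i ≫ pointMap j s = pointMap (i ≫ j) s := by
  refine extend_hom_ext ?_ ?_
  · rw [← Category.assoc, inl_extendMap, Category.assoc, inl_pointMap, inl_pointMap]
  · rw [← Category.assoc, inr_extendMap, inr_pointMap, inr_pointMap]

lemma pointMap_inl_inr : pointMap (inl B R) (inr B R) = 𝟙 _ :=
  extend_hom_ext (by simp) (by simp)

end extend

/-- Products of corepresentable functors are corepresentable. -/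
lemma isCorepresentable_of_prod {X Y Z : CommAlgCat.{u} k ⥤ Type u} (hX : X.IsCorepresentable)
    (hY : Y.IsCorepresentable) (a : Z ⟶ X) (b : Z ⟶ Y)
    (hZ : ∀ R (x : X.obj R) (y : Y.obj R), ∃! z : Z.obj R, a.app R z = x ∧ b.app R z = y) :
    Z.IsCorepresentable := by
  obtain ⟨D, x₀, hx⟩ := isCorepresentable_iff.1 hX
  obtain ⟨E, y₀, hy⟩ := isCorepresentable_iff.1 hY
  obtain ⟨z₀, ⟨hz₁, hz₂⟩, -⟩ := hZ (extend E D) (X.map (inl E D) x₀) (Y.map (inr E D) y₀)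
  refine isCorepresentable_iff.2 ⟨_, z₀, fun R z => ?_⟩
  obtain ⟨f, hf, -⟩ := hx R (a.app R z)
  obtain ⟨g, hg, -⟩ := hy R (b.app R z)
  have ha : ∀ t : extend E D ⟶ R, a.app R (Z.map t z₀) = X.map (inl E D ≫ t) x₀ := fun t => by
    rw [naturality_apply', hz₁, map_comp_apply']
  have hb : ∀ t : extend E D ⟶ R, b.app R (Z.map t z₀) = Y.map (inr E D ≫ t) y₀ := fun t => by
    rw [naturality_apply', hz₂, map_comp_apply']
  refine ⟨pointMap f g, ?_, fun t ht => ?_⟩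
  · refine (hZ R (a.app R z) (b.app R z)).unique ⟨?_, ?_⟩ ⟨rfl, rfl⟩
    · rw [ha, inl_pointMap, hf]
    · rw [hb, inr_pointMap, hg]
  · subst ht
    refine extend_hom_ext ?_ ?_
    · rw [inl_pointMap]
      exact hx.hom_ext ((ha t).symm.trans hf.symm)
    · rw [inr_pointMap]
      exact hy.hom_ext ((hb t).symm.trans hg.symm)

/-! ## Weil restriction along a finite algebra -/

/-- The functor `R ↦ R ⊗ B`. -/
def extendFunctor (B : CommAlgCat.{u} k) : CommAlgCat.{u} k ⥤ CommAlgCat.{u} k where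
  obj R := extend B R
  map j := extendMap B j
  map_id R := extendMap_id B R
  map_comp i j := extendMap_comp B i j

/-- Coordinates in a `k`-basis of `B` are natural in `R`, so an equation in `R ⊗ B` amounts to a
family of equations in `R`. -/
lemma basis_repr_extendMap {ι : Type*} (B : CommAlgCat.{u} k) (b : Module.Basis ι k B)
    {R S : CommAlgCat.{u} k} (j : R ⟶ S) (x : R ⊗[k] B) (i : ι) :
    (Algebra.TensorProduct.basis S b).repr ((extendMap B j).hom x) i =
      j.hom ((Algebra.TensorProduct.basis R b).repr x i) := by
  induction x using TensorProduct.induction_on with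
  | zero => simp
  | tmul r c =>
    rw [extendMap_tmul]
    simp [Algebra.TensorProduct.basis_repr_tmul, AlgHom.commutes]
  | add x y hx hy => simp only [map_add, hx, hy, Finsupp.add_apply]

/-- A variant of `isCorepresentable_of_closed` with equations in `R ⊗ B`. -/
lemma isCorepresentable_of_closed_extend (B : CommAlgCat.{u} k)
    {X Y : CommAlgCat.{u} k ⥤ Type u} (hY : Y.IsCorepresentable)
    (i : X ⟶ Y) (hi : ∀ R, Function.Injective (i.app R))
    (I : Set (Y ⟶ extendFunctor B ⋙ forget (CommAlgCat.{u} k)))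
    (hI : ∀ (R : CommAlgCat.{u} k) (y : Y.obj R),
      (∃ x, i.app R x = y) ↔ ∀ F ∈ I, @Eq (R ⊗[k] B) (F.app R y) 0) :
    X.IsCorepresentable := by
  let b := Module.Free.chooseBasis k B
  let coord (n : Module.Free.ChooseBasisIndex k B) :
      extendFunctor B ⋙ forget (CommAlgCat.{u} k) ⟶ forget (CommAlgCat.{u} k) :=
    { app := fun R => TypeCat.ofHom fun x : R ⊗[k] B =>
        (Algebra.TensorProduct.basis R b).repr x n
      naturality := fun R S j => by
        ext x
        exact basis_repr_extendMap B b j x n }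
  refine isCorepresentable_of_closed hY i hi {F | ∃ F' ∈ I, ∃ n, F' ≫ coord n = F} fun R y => ?_
  rw [hI]
  constructor
  · rintro h _ ⟨F, hF, n, rfl⟩
    change (Algebra.TensorProduct.basis R b).repr (F.app R y : R ⊗[k] B) n = 0
    refine (congrArg (fun t => (Algebra.TensorProduct.basis R b).repr t n) (h F hF)).trans ?_
    simp
  · intro h F hF
    refine (Algebra.TensorProduct.basis R b).repr.map_eq_zero_iff.1 (Finsupp.ext fun n => ?_)
    exact h _ ⟨F, hF, n, rfl⟩

/-- The functor `R ↦ (A → R ⊗ B)` for a type `A`. -/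
def functionsExtend (A : Type u) (B : CommAlgCat.{u} k) : CommAlgCat.{u} k ⥤ Type u where
  obj R := A → R ⊗[k] B
  map j := TypeCat.ofHom fun y a => (extendMap B j).hom (y a)
  map_id R := by
    ext y a
    change (extendMap B (𝟙 R)).hom (y a) = y a
    rw [extendMap_id]; rfl
  map_comp i j := by
    ext y a
    change (extendMap B (i ≫ j)).hom (y a) = (extendMap B j).hom ((extendMap B i).hom (y a))
    rw [extendMap_comp]; rfl

/-- As the basis of `B` is finite, the coordinates of a function can be chosen freely: this is an
affine space with one variable for each element of `A` and each basis vector. -/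
lemma functionsExtend_isCorepresentable (A : Type u) (B : CommAlgCat.{u} k) [Module.Finite k B] :
    (functionsExtend A B).IsCorepresentable := by
  let b := Module.Free.chooseBasis k B
  let D := CommAlgCat.of k (MvPolynomial (A × Module.Free.ChooseBasisIndex k B) k)
  let y₀ : A → D ⊗[k] B := fun a => (Algebra.TensorProduct.basis D b).equivFun.symm fun n =>
    MvPolynomial.X (a, n)
  refine isCorepresentable_iff.2 ⟨D, y₀, fun R y => ?_⟩
  change A → R ⊗[k] B at y
  have key : ∀ f : D ⟶ R, (functionsExtend A B).map f y₀ = y ↔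
      ∀ a n, f.hom (MvPolynomial.X (a, n)) = (Algebra.TensorProduct.basis R b).repr (y a) n := by
    intro f
    have h₀ : ∀ a n, f.hom (MvPolynomial.X (a, n)) =
        (Algebra.TensorProduct.basis R b).repr ((extendMap B f).hom (y₀ a)) n := by
      intro a n
      rw [basis_repr_extendMap, ← Module.Basis.equivFun_apply, LinearEquiv.apply_symm_apply]
    constructor
    · rintro h a n
      rw [h₀, ← h]; rfl
    · intro h
      funext a
      refine (Algebra.TensorProduct.basis R b).ext_elem fun n => ?_
      exact (h₀ a n).symm.trans (h a n)
  refine ⟨CommAlgCat.ofHom (MvPolynomial.aeval fun t =>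
    (Algebra.TensorProduct.basis R b).repr (y t.1) t.2), (key _).2 fun a n => ?_, fun f hf => ?_⟩
  · exact MvPolynomial.aeval_X _ _
  · refine CommAlgCat.hom_ext (MvPolynomial.algHom_ext fun t => ?_)
    simp [(key f).1 hf t.1 t.2]

/-- Among all functions `A → R ⊗ B`, the algebra maps are cut out by additivity, multiplicativity
and the values on scalars. -/
lemma extendFunctor_Sp_isCorepresentable (A B : CommAlgCat.{u} k) [Module.Finite k B] :
    (extendFunctor B ⋙ Sp A).IsCorepresentable := by
  let V := functionsExtend A B
  let i : extendFunctor B ⋙ Sp A ⟶ V :=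
    { app := fun R => TypeCat.ofHom fun (f : A ⟶ extend B R) (a : A) => f.hom a
      naturality := fun R S j => by ext x; rfl }
  let eqn (c : ∀ R : CommAlgCat.{u} k, (A → R ⊗[k] B) → R ⊗[k] B)
      (hc : ∀ {R S : CommAlgCat.{u} k} (j : R ⟶ S) (y : A → R ⊗[k] B),
        c S (fun a => (extendMap B j).hom (y a)) = (extendMap B j).hom (c R y)) :
      V ⟶ extendFunctor B ⋙ forget (CommAlgCat.{u} k) :=
    { app := fun R => TypeCat.ofHom (c R)
      naturality := fun R S j => by ext y; exact hc j y }
  let cAdd (t : A × A) := eqn (fun R y => y (t.1 + t.2) - (y t.1 + y t.2))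
    fun j y => by simp only [map_sub, map_add]
  let cMul (t : A × A) := eqn (fun R y => y (t.1 * t.2) - y t.1 * y t.2)
    fun j y => by simp only [map_sub, map_mul]
  let cAlg (r : k) := eqn (fun R y => y (algebraMap k A r) - algebraMap k (R ⊗[k] B) r)
    fun j y => by
      rw [map_sub]
      congr 1
      exact ((extendMap B j).hom.commutes r).symm
  refine isCorepresentable_of_closed_extend B (functionsExtend_isCorepresentable A B) i
    (fun R f g hfg => CommAlgCat.hom_ext (AlgHom.ext fun a => congrFun hfg a))
    (Set.range cAdd ∪ Set.range cMul ∪ Set.range cAlg) fun R y => ?_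
  change A → R ⊗[k] B at y
  constructor
  · rintro ⟨f, rfl⟩ F ((⟨t, rfl⟩ | ⟨t, rfl⟩) | ⟨r, rfl⟩)
    · exact (@sub_eq_zero (R ⊗[k] B) _ _ _).2 (map_add f.hom t.1 t.2)
    · exact (@sub_eq_zero (R ⊗[k] B) _ _ _).2 (map_mul f.hom t.1 t.2)
    · exact (@sub_eq_zero (R ⊗[k] B) _ _ _).2 (f.hom.commutes r)
  · intro h
    have hadd : ∀ a a', y (a + a') = y a + y a' := fun a a' =>
      (@sub_eq_zero (R ⊗[k] B) _ _ _).1 (h (cAdd (a, a')) (Or.inl (Or.inl ⟨_, rfl⟩)))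
    have hmul : ∀ a a', y (a * a') = y a * y a' := fun a a' =>
      (@sub_eq_zero (R ⊗[k] B) _ _ _).1 (h (cMul (a, a')) (Or.inl (Or.inr ⟨_, rfl⟩)))
    have halg : ∀ r, y (algebraMap k A r) = algebraMap k (R ⊗[k] B) r := fun r =>
      (@sub_eq_zero (R ⊗[k] B) _ _ _).1 (h (cAlg r) (Or.inr ⟨_, rfl⟩))
    -- Preservation of `0` and `1` comes from the equations for the scalars `0` and `1`.
    refine ⟨CommAlgCat.ofHom
      { toFun := y
        map_one' := (congrArg y (map_one _).symm).trans ((halg 1).trans (map_one _))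
        map_zero' := (congrArg y (map_zero _).symm).trans ((halg 0).trans (map_zero _))
        map_add' := hadd
        map_mul' := hmul
        commutes' := halg }, rfl⟩

/-- The Weil restriction of an affine scheme along a finite algebra over a field is affine. -/
lemma extendFunctor_comp_isCorepresentable {X : CommAlgCat.{u} k ⥤ Type u}
    (hX : X.IsCorepresentable) (B : CommAlgCat.{u} k) [Module.Finite k B] :
    (extendFunctor B ⋙ X).IsCorepresentable := by
  obtain ⟨A, ⟨h⟩⟩ := hX
  have := extendFunctor_Sp_isCorepresentable A B
  exact corepresentable_of_natIso _ (Functor.isoWhiskerLeft (extendFunctor B) h.toIso)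

/-! ## The automorphism functor -/

section autOp

variable {B R S T : CommAlgCat.{u} k}

@[simp] lemma inl_autHom (e : (autOp B).obj R) : inl B R ≫ autHom e = inl B R :=
  CommAlgCat.hom_ext (AlgHom.ext fun r =>
    AlgEquiv.commutes (show R ⊗[k] B ≃ₐ[R] R ⊗[k] B from e) r)

lemma autHom_injective {e e' : (autOp B).obj R} (h : autHom e = autHom e') : e = e' :=
  AlgEquiv.ext (f := (show R ⊗[k] B ≃ₐ[R] R ⊗[k] B from e)) fun x =>
    DFunLike.congr_fun (congrArg CommAlgCat.Hom.hom h) x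

/-- An automorphism fixes `R`, so it is determined by where it sends the universal point of `Σ_R`.
Equalities of automorphisms are checked there. -/
lemma autOp_ext {e e' : (autOp B).obj R} (h : inr B R ≫ autHom e = inr B R ≫ autHom e') :
    e = e' :=
  autHom_injective (extend_hom_ext (by simp) h)

lemma act_eq (j : R ⟶ S) (s : B ⟶ S) (e : (autOp B).obj R) :
    act j s e = inr B R ≫ autHom e ≫ pointMap j s := rfl

lemma act_inl_inr (e : (autOp B).obj R) : act (inl B R) (inr B R) e = inr B R ≫ autHom e := by
  rw [act_eq, pointMap_inl_inr, Category.comp_id]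

lemma autHom_pointMap (e : (autOp B).obj R) (j : R ⟶ S) (s : B ⟶ S) :
    autHom e ≫ pointMap j s = pointMap j (act j s e) := by
  refine extend_hom_ext ?_ ?_
  · rw [← Category.assoc, inl_autHom, inl_pointMap, inl_pointMap]
  · rw [inr_pointMap, act_eq]

lemma act_mul (j : R ⟶ S) (s : B ⟶ S) (e e' : (autOp B).obj R) :
    act j s (e * e') = act j (act j s e) e' := by
  rw [act_eq, autHom_mul, Category.assoc, autHom_pointMap]; rfl

lemma act_comp (j : R ⟶ S) (s : B ⟶ S) (e : (autOp B).obj R) (i : S ⟶ T) :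
    act j s e ≫ i = act (j ≫ i) (s ≫ i) e := by
  rw [act_eq, act_eq, ← pointMap_comp, Category.assoc, Category.assoc]

lemma inr_autHom_map (i : R ⟶ S) (e : (autOp B).obj R) :
    inr B S ≫ autHom ((autOp B).map i e) = (inr B R ≫ autHom e) ≫ extendMap B i := by
  rw [Category.assoc, extendMap_autHom, ← Category.assoc, inr_extendMap]

lemma act_map (i : R ⟶ S) (j : S ⟶ T) (s : B ⟶ T) (e : (autOp B).obj R) :
    act j s ((autOp B).map i e) = act (i ≫ j) s e := by
  rw [act_eq, ← Category.assoc, inr_autHom_map, act_eq, Category.assoc, Category.assoc,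
    extendMap_pointMap]

/-- The automorphism of `Σ_R` given by a mutually inverse pair of endomorphisms. -/
def mkAut (u v : B ⟶ extend B R) (hvu : v ≫ pointMap (inl B R) u = inr B R)
    (huv : u ≫ pointMap (inl B R) v = inr B R) : (autOp B).obj R :=
  let toHom (w : B ⟶ extend B R) : R ⊗[k] B →ₐ[R] R ⊗[k] B :=
    { (pointMap (inl B R) w).hom with
      commutes' := fun r => DFunLike.congr_fun
        (congrArg CommAlgCat.Hom.hom (inl_pointMap (inl B R) w)) r }
  have key : ∀ a b : B ⟶ extend B R, b ≫ pointMap (inl B R) a = inr B R →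
      (toHom a).comp (toHom b) = AlgHom.id R _ := fun a b h => by
    have h' : pointMap (inl B R) b ≫ pointMap (inl B R) a = 𝟙 _ := by
      rw [pointMap_comp, inl_pointMap, h, pointMap_inl_inr]
    exact AlgHom.ext fun x => DFunLike.congr_fun (congrArg CommAlgCat.Hom.hom h') x
  AlgEquiv.ofAlgHom (toHom u) (toHom v) (key u v hvu) (key v u huv)

lemma inr_autHom_mkAut (u v : B ⟶ extend B R) (hvu : v ≫ pointMap (inl B R) u = inr B R)
    (huv : u ≫ pointMap (inl B R) v = inr B R) :
    inr B R ≫ autHom (mkAut u v hvu huv) = u :=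
  inr_pointMap (inl B R) u

lemma inr_autHom_mkAut_inv (u v : B ⟶ extend B R) (hvu : v ≫ pointMap (inl B R) u = inr B R)
    (huv : u ≫ pointMap (inl B R) v = inr B R) :
    inr B R ≫ autHom (mkAut u v hvu huv)⁻¹ = v :=
  inr_pointMap (inl B R) v

end autOp

/-- The automorphism functor of a finite scheme over a field is an affine group scheme. -/
lemma autOp_isProalgebraic (B : CommAlgCat.{u} k) [Module.Finite k B] :
    IsProalgebraic (autOp B) := by
  let E := extendFunctor B ⋙ Sp B
  have hE : E.IsCorepresentable := extendFunctor_Sp_isCorepresentable B B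
  -- Recording the inverse alongside the automorphism turns invertibility into the closed condition
  -- that the two composites are the identity.
  let Y := FunctorToTypes.prod E E
  have hY : Y.IsCorepresentable :=
    isCorepresentable_of_prod hE hE FunctorToTypes.prod.fst FunctorToTypes.prod.snd
      fun R x y => ⟨(x, y), ⟨rfl, rfl⟩, fun z hz => Prod.ext hz.1 hz.2⟩
  let i : (autOp B).sets ⟶ Y :=
    { app := fun R => TypeCat.ofHom fun e : (autOp B).obj R =>
        ((inr B R ≫ autHom e, inr B R ≫ autHom e⁻¹) :
          (B ⟶ extend B R) × (B ⟶ extend B R))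
      naturality := fun R S j => by
        ext e
        · exact inr_autHom_map j e
        · have h := inr_autHom_map j e⁻¹
          rw [map_inv] at h
          exact h }
  let eqn (c : ∀ R : CommAlgCat.{u} k, (B ⟶ extend B R) → (B ⟶ extend B R) → B → R ⊗[k] B)
      (hc : ∀ {R S : CommAlgCat.{u} k} (j : R ⟶ S) (u v : B ⟶ extend B R) (b : B),
        c S (u ≫ extendMap B j) (v ≫ extendMap B j) b = (extendMap B j).hom (c R u v b)) (b : B) :
      Y ⟶ extendFunctor B ⋙ forget (CommAlgCat.{u} k) :=
    { app := fun R => TypeCat.ofHom fun y => c R y.1 y.2 b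
      naturality := fun R S j => by ext y; exact hc j y.1 y.2 b }
  have nat : ∀ {R S : CommAlgCat.{u} k} (j : R ⟶ S) (u v : B ⟶ extend B R),
      (v ≫ extendMap B j) ≫ pointMap (inl B S) (u ≫ extendMap B j) =
        (v ≫ pointMap (inl B R) u) ≫ extendMap B j := fun j u v => by
    rw [Category.assoc, Category.assoc, extendMap_pointMap, pointMap_comp, inl_extendMap]
  let c₁ := eqn (fun R u v b => (v ≫ pointMap (inl B R) u).hom b - (inr B R).hom b)
    fun j u v b => by rw [nat, ← inr_extendMap j, map_sub]; rfl
  let c₂ := eqn (fun R u v b => (u ≫ pointMap (inl B R) v).hom b - (inr B R).hom b)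
    fun j u v b => by rw [nat, ← inr_extendMap j, map_sub]; rfl
  refine isCorepresentable_of_closed_extend B hY i
    (fun R e e' h => autOp_ext (congrArg Prod.fst h)) (Set.range c₁ ∪ Set.range c₂) fun R y => ?_
  have inv : ∀ e e' : (autOp B).obj R, e * e' = 1 →
      (inr B R ≫ autHom e') ≫ pointMap (inl B R) (inr B R ≫ autHom e) = inr B R := by
    intro e e' h
    rw [← act_inl_inr e, ← autHom_pointMap, pointMap_inl_inr, Category.comp_id, Category.assoc,
      ← autHom_mul, h, autHom_one, Category.comp_id]
  constructor
  · rintro ⟨e, rfl⟩ F (⟨b, rfl⟩ | ⟨b, rfl⟩)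
    · refine (@sub_eq_zero (R ⊗[k] B) _ _ _).2 ?_
      exact DFunLike.congr_fun (congrArg CommAlgCat.Hom.hom (inv e e⁻¹ (mul_inv_cancel e))) b
    · refine (@sub_eq_zero (R ⊗[k] B) _ _ _).2 ?_
      exact DFunLike.congr_fun (congrArg CommAlgCat.Hom.hom (inv e⁻¹ e (inv_mul_cancel e))) b
  · intro h
    obtain ⟨u, v⟩ := y
    have hvu : v ≫ pointMap (inl B R) u = inr B R :=
      CommAlgCat.hom_ext (AlgHom.ext fun b =>
        (@sub_eq_zero (R ⊗[k] B) _ _ _).1 (h (c₁ b) (Or.inl ⟨b, rfl⟩)))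
    have huv : u ≫ pointMap (inl B R) v = inr B R :=
      CommAlgCat.hom_ext (AlgHom.ext fun b =>
        (@sub_eq_zero (R ⊗[k] B) _ _ _).1 (h (c₂ b) (Or.inr ⟨b, rfl⟩)))
    exact ⟨mkAut u v hvu huv, Prod.ext (inr_autHom_mkAut u v hvu huv)
      (inr_autHom_mkAut_inv u v hvu huv)⟩

/-! ## The coset space when the projection has a section -/

section coset

variable {G : GroupFunctor k} {H : SubgroupFunctor G} {B : CommAlgCat.{u} k}
  {p : cosetFunctor H ⟶ Sp B} {T : Sp B ⟶ G.sets}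

lemma proj_map (p : cosetFunctor H ⟶ Sp B) {R S : CommAlgCat.{u} k} (j : R ⟶ S) (x : G.obj R) :
    proj p (G.map j x) = proj p x ≫ j :=
  naturality_apply' (toCoset H ≫ p) j x

lemma pointOf_map (T : Sp B ⟶ G.sets) {R S : CommAlgCat.{u} k} (j : R ⟶ S) (s : B ⟶ R) :
    pointOf T (s ≫ j) = G.map j (pointOf T s) :=
  naturality_apply' T j s

lemma proj_pointOf (hT : T ≫ toCoset H ≫ p = 𝟙 (Sp B)) {R : CommAlgCat.{u} k} (s : B ⟶ R) :
    proj p (pointOf T s) = s :=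
  ConcreteCategory.congr_hom (NatTrans.congr_app hT R) s

/-- The defining equations are natural, and their vanishing is detected after an injective map of
algebras. -/
lemma SubgroupFunctor.IsClosed.mem_of_map_mem (hH : H.IsClosed) {R S : CommAlgCat.{u} k}
    {j : R ⟶ S} (hj : Function.Injective j.hom) {x : G.obj R} (hx : G.map j x ∈ H.obj S) :
    x ∈ H.obj R := by
  obtain ⟨I, hI⟩ := hH
  rw [hI] at hx ⊢
  intro F hF
  refine hj ((naturality_apply' F j x).symm.trans ?_)
  exact (hx F hF).trans (map_zero _).symm

/-- The fibres of the projection to the coset space are the cosets. -/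
lemma proj_eq_iff (hH : H.IsClosed) (hp : IsCosetSpace H p) {R : CommAlgCat.{u} k}
    {x y : G.obj R} : proj p x = proj p y ↔ y * x⁻¹ ∈ H.obj R := by
  have coset : ∀ {R : CommAlgCat.{u} k} (x y : G.obj R),
      (toCoset H).app R x = (toCoset H).app R y ↔ y * x⁻¹ ∈ H.obj R := fun x y =>
    Quotient.eq.trans QuotientGroup.rightRel_apply
  constructor
  · intro h
    obtain ⟨S, j, hj, e⟩ := hp.locally_injective R _ _ h
    replace e : (toCoset H).app S (G.map j x) = (toCoset H).app S (G.map j y) := e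
    rw [coset] at e
    -- Equality of cosets holds only after a faithfully flat extension, but such an extension is
    -- injective.
    refine hH.mem_of_map_mem hj.injective ?_
    rw [map_mul, map_inv]
    exact e
  · intro h
    exact congrArg (p.app R) ((coset x y).2 h)

lemma proj_mul_right (hH : H.IsClosed) (hp : IsCosetSpace H p) {R : CommAlgCat.{u} k}
    {x y : G.obj R} (h : proj p x = proj p y) (g : G.obj R) : proj p (x * g) = proj p (y * g) := by
  rw [proj_eq_iff hH hp] at h ⊢
  simpa [mul_assoc] using h

/-- Since `T(s)` lifts `s`, equivariance of `π` leaves no choice; uniqueness of the action follows.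
-/
lemma IsNaturalAction.act_eq {ρ : G ⟶ autOp B} (hρ : IsNaturalAction p ρ)
    (hT : T ≫ toCoset H ≫ p = 𝟙 (Sp B)) {R S : CommAlgCat.{u} k} (j : R ⟶ S) (s : B ⟶ S)
    (g : G.obj R) : act j s (ρ.app R g) = proj p (pointOf T s * G.map j g) := by
  rw [← hρ j g (pointOf T s), proj_pointOf hT]

lemma IsNaturalAction.unique {ρ ρ' : G ⟶ autOp B} (hρ : IsNaturalAction p ρ)
    (hρ' : IsNaturalAction p ρ') (hT : T ≫ toCoset H ≫ p = 𝟙 (Sp B)) : ρ = ρ' := by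
  ext R g
  refine autOp_ext ?_
  rw [← act_inl_inr, ← act_inl_inr, hρ.act_eq hT, hρ'.act_eq hT]

/-- Right translation by `g ∈ G(R)` of the universal point of `Σ_R`. -/
def translate (p : cosetFunctor H ⟶ Sp B) (T : Sp B ⟶ G.sets) {R : CommAlgCat.{u} k}
    (g : G.obj R) : B ⟶ extend B R :=
  proj p (pointOf T (inr B R) * G.map (inl B R) g)

lemma translate_pointMap (p : cosetFunctor H ⟶ Sp B) (T : Sp B ⟶ G.sets) {R S : CommAlgCat.{u} k}
    (g : G.obj R) (j : R ⟶ S) (s : B ⟶ S) :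
    translate p T g ≫ pointMap j s = proj p (pointOf T s * G.map j g) := by
  rw [translate, ← proj_map, map_mul, ← pointOf_map, inr_pointMap, map_map_apply, inl_pointMap]

/-- `T(sg)` and `T(s)g` may differ, but they lie over the same point, and right multiplication by
`h` respects the fibres of `π`. -/
lemma translate_comp (hH : H.IsClosed) (hp : IsCosetSpace H p)
    (hT : T ≫ toCoset H ≫ p = 𝟙 (Sp B)) {R : CommAlgCat.{u} k} (g h : G.obj R) :
    translate p T h ≫ pointMap (inl B R) (translate p T g) = translate p T (g * h) := by
  have hmap : pointOf T (inr B R) * G.map (inl B R) (g * h) =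
      pointOf T (inr B R) * G.map (inl B R) g * G.map (inl B R) h := by
    rw [map_mul, mul_assoc]
  rw [translate_pointMap, translate, translate, hmap]
  exact proj_mul_right hH hp (proj_pointOf hT _) _

lemma translate_one (hT : T ≫ toCoset H ≫ p = 𝟙 (Sp B)) {R : CommAlgCat.{u} k} :
    translate p T (1 : G.obj R) = inr B R := by
  rw [translate, map_one, mul_one, proj_pointOf hT]

/-- The natural action of `G` on the coset space. -/
lemma exists_isNaturalAction (hH : H.IsClosed) (hp : IsCosetSpace H p)
    (hT : T ≫ toCoset H ≫ p = 𝟙 (Sp B)) : ∃ ρ : G ⟶ autOp B, IsNaturalAction p ρ := by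
  have comp : ∀ {R : CommAlgCat.{u} k} (g h : G.obj R), g * h = 1 →
      translate p T h ≫ pointMap (inl B R) (translate p T g) = inr B R := fun g h hgh => by
    rw [translate_comp hH hp hT, hgh, translate_one hT]
  let a {R : CommAlgCat.{u} k} (g : G.obj R) : (autOp B).obj R :=
    mkAut (translate p T g) (translate p T g⁻¹) (comp _ _ (mul_inv_cancel g))
      (comp _ _ (inv_mul_cancel g))
  have ha : ∀ {R : CommAlgCat.{u} k} (g : G.obj R), inr B R ≫ autHom (a g) = translate p T g :=
    fun g => inr_autHom_mkAut _ _ _ _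
  have hact : ∀ {R S : CommAlgCat.{u} k} (j : R ⟶ S) (s : B ⟶ S) (g : G.obj R),
      act j s (a g) = proj p (pointOf T s * G.map j g) := fun j s g => by
    rw [Proalg.act_eq, ← Category.assoc, ha, translate_pointMap]
  have hmul : ∀ {R : CommAlgCat.{u} k} (g h : G.obj R), a (g * h) = a g * a h := fun g h =>
    autOp_ext <| by
      rw [ha, ← act_inl_inr, act_mul, act_inl_inr, ha, ← translate_comp hH hp hT,
        Proalg.act_eq, ← Category.assoc, ha]
  refine ⟨{ app := fun R => GrpCat.ofHom (MonoidHom.mk' a hmul)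
            naturality := fun R S j => ?_ }, fun j g x => ?_⟩
  · ext g
    refine autOp_ext ?_
    change inr B S ≫ autHom (a (G.map j g)) = inr B S ≫ autHom ((autOp B).map j (a g))
    rw [inr_autHom_map, ha, ha, translate, translate, ← proj_map, map_mul, ← pointOf_map,
      inr_extendMap, map_map_apply, map_map_apply, inl_extendMap]
  -- The action was defined through `T(π(x))`, which lies in the same fibre as `x`.
  · exact (hact j _ g).trans (proj_mul_right hH hp (proj_pointOf hT _) _)

end coset

/-! ## The scheme theoretic image -/

section image

variable {G W : GroupFunctor k}

lemma GroupFunctor.value_map (F : Functions G.sets) {R S : CommAlgCat.{u} k} (j : R ⟶ S)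
    (x : G.obj R) : value F (G.map j x) = j.hom (value F x) :=
  naturality_apply' F j x

lemma app_map (φ : G ⟶ W) {R S : CommAlgCat.{u} k} (j : R ⟶ S) (g : G.obj R) :
    φ.app S (G.map j g) = W.map j (φ.app R g) :=
  ConcreteCategory.congr_hom (φ.naturality j) g

/-- The pull-back of `F` along `φ` vanishes. -/
def VanishesAlong (φ : G ⟶ W) (F : Functions W.sets) : Prop :=
  ∀ (S : CommAlgCat.{u} k) (g : G.obj S), GroupFunctor.value F (φ.app S g) = 0

/-- The zero locus of the kernel of the dual map of `φ` is closed under multiplication. -/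
lemma value_mul_eq_zero (hG : IsProalgebraic G) (hW : IsProalgebraic W) (φ : G ⟶ W)
    {R : CommAlgCat.{u} k} {x y : W.obj R}
    (hx : ∀ F, VanishesAlong φ F → GroupFunctor.value F x = 0)
    (hy : ∀ F, VanishesAlong φ F → GroupFunctor.value F y = 0)
    (F : Functions W.sets) (hF : VanishesAlong φ F) : GroupFunctor.value F (x * y) = 0 := by
  obtain ⟨D, w₀, hw⟩ := isCorepresentable_iff.1 hW
  obtain ⟨A, g₀, hg⟩ := isCorepresentable_iff.1 hG
  change W.obj D at w₀
  change G.obj A at g₀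
  have hw' : ∀ {S : CommAlgCat.{u} k} (z : W.obj S), ∃ f : D ⟶ S, W.map f w₀ = z :=
    fun z => (hw _ z).exists
  have hg' : ∀ {S : CommAlgCat.{u} k} (z : G.obj S), ∃ f : A ⟶ S, G.map f g₀ = z :=
    fun z => (hg _ z).exists
  obtain ⟨ψ, hψ⟩ := hw' (φ.app A g₀)
  -- `C` is the coordinate ring of the image of `φ`, embedded in that of `G`. A point killed by the
  -- kernel is one whose classifying map factors through `C`.
  let C : CommAlgCat.{u} k := CommAlgCat.of k (D ⧸ RingHom.ker ψ.hom)
  let q : D ⟶ C := CommAlgCat.ofHom (Ideal.Quotient.mkₐ k _)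
  let m : C ⟶ A := CommAlgCat.ofHom (Ideal.kerLiftAlg ψ.hom)
  have hm : Function.Injective m.hom := Ideal.kerLiftAlg_injective ψ.hom
  have hqm : q ≫ m = ψ := rfl
  have factor : ∀ z : W.obj R, (∀ F, VanishesAlong φ F → GroupFunctor.value F z = 0) →
      ∃ f : C ⟶ R, W.map f (W.map q w₀) = z := by
    intro z hz
    obtain ⟨f, rfl⟩ := hw' z
    have hf : ∀ d ∈ RingHom.ker ψ.hom, f.hom d = 0 := by
      intro d hd
      obtain ⟨F, hF⟩ := hw.exists_function d
      refine (hF R f).symm.trans (hz F fun S g => ?_)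
      obtain ⟨a, rfl⟩ := hg' g
      rw [app_map, ← hψ, GroupFunctor.value_map]
      exact (congrArg a.hom ((hF A ψ).trans hd)).trans (map_zero _)
    exact ⟨CommAlgCat.ofHom (Ideal.Quotient.liftₐ _ f.hom hf), map_map_apply W _ _ _⟩
  obtain ⟨f, rfl⟩ := factor x hx
  obtain ⟨g, rfl⟩ := factor y hy
  -- It suffices to treat the universal pair of such points, over `C ⊗ C`. Over a field this embeds
  -- in `A ⊗ A`, where the product of the pair is the image under `φ` of a product in `G`.
  let t : extend C C ⟶ extend A A :=
    CommAlgCat.ofHom (Algebra.TensorProduct.map m.hom m.hom)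
  have ht : Function.Injective t.hom :=
    TensorProduct.map_injective_of_flat_flat m.hom.toLinearMap m.hom.toLinearMap hm hm
  have hlt : inl C C ≫ t = m ≫ inl A A :=
    CommAlgCat.hom_ext (AlgHom.ext fun c => by simp [t, inl])
  have hrt : inr C C ≫ t = m ≫ inr A A :=
    CommAlgCat.hom_ext (AlgHom.ext fun c => by simp [t, inr])
  have hzero : GroupFunctor.value F
      (W.map (inl C C) (W.map q w₀) * W.map (inr C C) (W.map q w₀)) = 0 := by
    refine ht ?_
    rw [← GroupFunctor.value_map, map_zero, map_mul, map_map_apply, map_map_apply W (inr C C),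
      hlt, hrt, ← map_map_apply W m, ← map_map_apply W m, map_map_apply W q, hqm, hψ,
      ← app_map, ← app_map, ← map_mul]
    exact hF _ _
  have hxy : W.map f (W.map q w₀) * W.map g (W.map q w₀) = W.map (pointMap f g)
      (W.map (inl C C) (W.map q w₀) * W.map (inr C C) (W.map q w₀)) := by
    rw [map_mul, map_map_apply W (inl C C), map_map_apply W (inr C C), inl_pointMap, inr_pointMap]
  rw [hxy, GroupFunctor.value_map, hzero, map_zero]

/-- The zero locus of the kernel of the dual map of `φ`, as a subgroup functor. -/
def kernelLocus (hG : IsProalgebraic G) (hW : IsProalgebraic W) (φ : G ⟶ W) :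
    SubgroupFunctor W where
  obj R :=
    { carrier := {x | ∀ F, VanishesAlong φ F → GroupFunctor.value F x = 0}
      mul_mem' := fun hx hy => value_mul_eq_zero hG hW φ hx hy
      one_mem' := fun F hF => by
        rw [← map_one (φ.app R).hom]
        exact hF R 1
      inv_mem' := fun {x} hx F hF => by
        let F' : Functions W.sets :=
          { app := fun S => TypeCat.ofHom fun y : W.obj S => GroupFunctor.value F y⁻¹
            naturality := fun S S' j => by
              ext y
              change GroupFunctor.value F (W.map j y)⁻¹ = j.hom (GroupFunctor.value F y⁻¹)
              rw [← map_inv, GroupFunctor.value_map] }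
        refine hx F' fun S g => ?_
        change GroupFunctor.value F (φ.app S g)⁻¹ = 0
        rw [← map_inv]
        exact hF S g⁻¹ }
  map_mem j x hx F hF := by rw [GroupFunctor.value_map, hx F hF, map_zero]

/-- The kernel locus is one of the closed subgroups being intersected; conversely, the equations of
any closed subgroup through which `φ` factors lie in the kernel. -/
lemma image_obj_eq (hG : IsProalgebraic G) (hW : IsProalgebraic W) (φ : G ⟶ W)
    (R : CommAlgCat.{u} k) : (image φ).obj R = (kernelLocus hG hW φ).obj R := by
  refine le_antisymm ?_ ?_
  · exact iInf_le_of_le (kernelLocus hG hW φ) (iInf₂_le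
      ⟨{F | VanishesAlong φ F}, fun _ _ => Iff.rfl⟩ fun S g F hF => hF S g)
  · refine le_iInf fun Z => le_iInf₂ fun ⟨I, hI⟩ hφ x hx => ?_
    exact (hI R x).2 fun F hF => hx F fun S g => (hI S _).1 (hφ S g) F hF

lemma isZeroLocusOfKernel_image (hG : IsProalgebraic G) (hW : IsProalgebraic W) (φ : G ⟶ W) :
    IsZeroLocusOfKernel φ (image φ) := by
  intro R x
  rw [image_obj_eq hG hW φ R]
  rfl

lemma IsZeroLocusOfKernel.isClosed {φ : G ⟶ W} {Z : SubgroupFunctor W}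
    (h : IsZeroLocusOfKernel φ Z) : Z.IsClosed :=
  ⟨{F | VanishesAlong φ F}, h⟩

lemma app_mem_image (φ : G ⟶ W) {R : CommAlgCat.{u} k} (g : G.obj R) :
    φ.app R g ∈ (image φ).obj R := by
  simp only [image, Subgroup.mem_iInf]
  exact fun Z _ hφ => hφ R g

/-- Closed subgroups of proalgebraic groups are proalgebraic. -/
lemma SubgroupFunctor.IsClosed.isProalgebraic {Z : SubgroupFunctor W} (hZ : Z.IsClosed)
    (hW : IsProalgebraic W) : IsProalgebraic Z.toFunctor := by
  obtain ⟨I, hI⟩ := hZ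
  let i : Z.toFunctor.sets ⟶ W.sets := Functor.whiskerRight Z.incl (forget GrpCat)
  refine isCorepresentable_of_closed hW i (fun R x y h => Subtype.ext h) I fun R y => ?_
  refine Iff.trans ?_ (hI R y)
  exact ⟨fun ⟨x, hx⟩ => hx ▸ x.2, fun h => ⟨⟨y, h⟩, rfl⟩⟩

end image

/-! ## Embedding a group with a retraction -/

/-- A morphism to an affine group scheme that has a retraction as a morphism of schemes is a closed
embedding. -/
lemma isClosedEmbedding_of_retraction {G W : GroupFunctor k} (hW : IsProalgebraic W) (φ : G ⟶ W)
    (r : W.sets ⟶ G.sets)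
    (hr : ∀ (R : CommAlgCat.{u} k) (g : G.obj R), r.app R (φ.app R g) = g) :
    IsClosedEmbedding φ := by
  have hinj : ∀ R, Function.Injective (φ.app R) := fun R => Function.LeftInverse.injective (hr R)
  let Z : SubgroupFunctor W :=
    { obj := fun R => (φ.app R).hom.range
      map_mem := by
        rintro R S j _ ⟨g, rfl⟩
        exact ⟨G.map j g, app_map φ j g⟩ }
  let rφ (R : CommAlgCat.{u} k) (w : W.obj R) : W.obj R := φ.app R (r.app R w)
  have hrφ : ∀ {R S : CommAlgCat.{u} k} (j : R ⟶ S) (w : W.obj R),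
      rφ S (W.map j w) = W.map j (rφ R w) := fun {R S} j w =>
    (congrArg (φ.app S) (naturality_apply' r j w)).trans (app_map φ j _)
  -- The image is the locus `φ(r(w)) = w`. Regular functions separate the points of `W`, so
  -- comparing their values at both sides gives its equations.
  let diff (F : Functions W.sets) : Functions W.sets :=
    { app := fun R => TypeCat.ofHom fun w : W.obj R =>
        GroupFunctor.value F (rφ R w) - GroupFunctor.value F w
      naturality := fun R S j => by
        ext w
        change GroupFunctor.value F (rφ S (W.map j w)) - GroupFunctor.value F (W.map j w) =
          j.hom (GroupFunctor.value F (rφ R w) - GroupFunctor.value F w)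
        rw [hrφ, GroupFunctor.value_map, GroupFunctor.value_map, map_sub] }
  refine ⟨Z, ⟨Set.range diff, fun R w => ⟨?_, fun h => ?_⟩⟩, ?_⟩
  · rintro ⟨g, rfl⟩ _ ⟨F, rfl⟩
    refine sub_eq_zero.2 (congrArg (GroupFunctor.value F) ?_)
    exact congrArg (φ.app R) (hr R g)
  · refine ⟨r.app R w, eq_of_functions (X := W.sets) hW fun F => ?_⟩
    exact sub_eq_zero.1 (h (diff F) ⟨F, rfl⟩)
  · refine ⟨NatIso.ofComponents (fun R => MulEquiv.toGrpIso
      (MonoidHom.ofInjective (f := (φ.app R).hom) (hinj R))) fun {R S} j => ?_, ?_⟩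
    · ext g
      exact Subtype.ext (app_map φ j g)
    · ext R g
      rfl

/-! ## The wreath product and the embedding -/

/-- Wreath products of proalgebraic groups along a finite scheme are proalgebraic. -/
lemma wreath_isProalgebraic {A Γ : GroupFunctor k} {B : CommAlgCat.{u} k} [Module.Finite k B]
    (hA : IsProalgebraic A) (hΓ : IsProalgebraic Γ) (σ : Γ ⟶ autOp B) :
    IsProalgebraic (wreath A σ) := by
  let a : (wreath A σ).sets ⟶ extendFunctor B ⋙ A.sets :=
    { app := fun R => TypeCat.ofHom fun w : (wreath A σ).obj R => wreathLeft w
      naturality := fun R S j => by ext w; rfl }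
  let b : (wreath A σ).sets ⟶ Γ.sets :=
    { app := fun R => TypeCat.ofHom fun w : (wreath A σ).obj R => wreathRight w
      naturality := fun R S j => by ext w; rfl }
  exact isCorepresentable_of_prod (extendFunctor_comp_isCorepresentable hA B) hΓ a b
    fun R x y => ⟨SemidirectProduct.mk x y, ⟨rfl, rfl⟩, fun z hz =>
      SemidirectProduct.ext hz.1 hz.2⟩

/-! ### The cocycle `f_g`, the homomorphism `φ` and its retraction -/

section cocycle

variable {G : GroupFunctor k} {H : SubgroupFunctor G} {B : CommAlgCat.{u} k}
  {p : cosetFunctor H ⟶ Sp B} {T : Sp B ⟶ G.sets} {ρ : G ⟶ autOp B} {R S S' : CommAlgCat.{u} k}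

/-- The element `T(s) g T(sg)⁻¹`. -/
def cocycle (T : Sp B ⟶ G.sets) (ρ : G ⟶ autOp B) (j : R ⟶ S) (s : B ⟶ S) (g : G.obj R) :
    G.obj S :=
  pointOf T s * G.map j g * (pointOf T (act j s (ρ.app R g)))⁻¹

lemma map_cocycle (j : R ⟶ S) (s : B ⟶ S) (g : G.obj R) (i : S ⟶ S') :
    G.map i (cocycle T ρ j s g) = cocycle T ρ (j ≫ i) (s ≫ i) g := by
  rw [cocycle, map_mul, map_mul, map_inv, ← pointOf_map, ← pointOf_map, act_comp, map_map_apply]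
  rfl

lemma cocycle_map (i : R ⟶ S) (j : S ⟶ S') (s : B ⟶ S') (g : G.obj R) :
    cocycle T ρ j s (G.map i g) = cocycle T ρ (i ≫ j) s g := by
  rw [cocycle, map_map_apply, app_map, act_map]
  rfl

/-- The inner factors `T(sg)⁻¹ T(sg)` cancel. This is exactly multiplicativity in the semidirect
product. -/
lemma cocycle_mul (j : R ⟶ S) (s : B ⟶ S) (g h : G.obj R) :
    cocycle T ρ j s (g * h) = cocycle T ρ j s g * cocycle T ρ j (act j s (ρ.app R g)) h := by
  rw [cocycle, cocycle, cocycle, map_mul, map_mul, act_mul]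
  group

/-- `T(s)g` and `T(sg)` both lie over `sg`, hence in one coset of `H`. -/
lemma cocycle_mem (hH : H.IsClosed) (hp : IsCosetSpace H p)
    (hT : T ≫ toCoset H ≫ p = 𝟙 (Sp B)) (hρ : IsNaturalAction p ρ)
    (j : R ⟶ S) (s : B ⟶ S) (g : G.obj R) : cocycle T ρ j s g ∈ H.obj S := by
  rw [cocycle, ← proj_eq_iff hH hp, proj_pointOf hT, hρ.act_eq hT]

lemma autHom_eq_pointMap (e : (autOp B).obj R) :
    autHom e = pointMap (inl B R) (act (inl B R) (inr B R) e) := by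
  rw [← autHom_pointMap, pointMap_inl_inr, Category.comp_id]

lemma incl_map (H : SubgroupFunctor G) (j : R ⟶ S) (x : H.toFunctor.obj R) :
    H.incl.app S (H.toFunctor.map j x) = G.map j (H.incl.app R x) := rfl

lemma incl_injective (H : SubgroupFunctor G) : Function.Injective (H.incl.app R) :=
  Subtype.val_injective

/-- The element `f_g` of `H^Σ(R)`. -/
def wreathCocycle (hmem : ∀ {R S : CommAlgCat.{u} k} (j : R ⟶ S) (s : B ⟶ S) (g : G.obj R),
    cocycle T ρ j s g ∈ H.obj S) (g : G.obj R) : (power H.toFunctor B).obj R :=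
  (⟨cocycle T ρ (inl B R) (inr B R) g, hmem _ _ _⟩ : H.obj (extend B R))

variable (hmem : ∀ {R S : CommAlgCat.{u} k} (j : R ⟶ S) (s : B ⟶ S) (g : G.obj R),
    cocycle T ρ j s g ∈ H.obj S)

/-- `f_g` is defined by its value at the universal point; naturality of the cocycle specialises this
to every point. -/
lemma incl_eval_wreathCocycle (g : G.obj R) (j : R ⟶ S) (s : B ⟶ S) :
    H.incl.app S (eval (wreathCocycle hmem g) j s) = cocycle T ρ j s g := by
  refine (incl_map H (pointMap j s) _).trans ((map_cocycle _ _ g _).trans ?_)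
  rw [inl_pointMap, inr_pointMap]

lemma wreathCocycle_mul (g h : G.obj R) :
    wreathCocycle hmem (g * h) =
      wreathCocycle hmem g * powerAction H.toFunctor B R (ρ.app R g) (wreathCocycle hmem h) := by
  refine incl_injective H ?_
  have h₁ : H.incl.app _ (powerAction H.toFunctor B R (ρ.app R g) (wreathCocycle hmem h)) =
      cocycle T ρ (inl B R) (act (inl B R) (inr B R) (ρ.app R g)) h := by
    refine Eq.trans ?_ (incl_eval_wreathCocycle hmem h _ _)
    rw [eval, ← autHom_eq_pointMap]
    rfl
  refine (cocycle_mul _ _ g h).trans ?_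
  rw [← h₁]
  rfl

lemma map_wreathCocycle (j : R ⟶ S) (g : G.obj R) :
    wreathCocycle hmem (G.map j g) = (power H.toFunctor B).map j (wreathCocycle hmem g) := by
  refine incl_injective H ?_
  refine (cocycle_map _ _ _ g).trans (Eq.trans ?_ (map_cocycle _ _ g _).symm)
  rw [inl_extendMap, inr_extendMap]

/-- The morphism `g ↦ (f_g, ρ(g))`. -/
def toWreath : G ⟶ wreath H.toFunctor (image ρ).incl where
  app R := GrpCat.ofHom <| MonoidHom.mk'
    (fun g : G.obj R => (show (wreath H.toFunctor (image ρ).incl).obj R from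
      SemidirectProduct.mk (wreathCocycle hmem g) ⟨ρ.app R g, app_mem_image ρ g⟩))
    fun g h => SemidirectProduct.ext (wreathCocycle_mul hmem g h)
      (Subtype.ext (map_mul (ρ.app R).hom g h))
  naturality R S j := by
    ext g
    exact SemidirectProduct.ext (map_wreathCocycle hmem j g) (Subtype.ext (app_map ρ j g))

lemma map_eval {A : GroupFunctor k} (f : (power A B).obj R) (j : R ⟶ S) (s : B ⟶ S)
    (i : S ⟶ S') : A.map i (eval f j s) = eval f (j ≫ i) (s ≫ i) := by
  refine (map_map_apply A _ _ f).trans ?_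
  rw [pointMap_comp]
  rfl

lemma eval_map {A : GroupFunctor k} (f : (power A B).obj R) (i : R ⟶ S) (j : S ⟶ S')
    (s : B ⟶ S') : eval ((power A B).map i f) j s = eval f (i ≫ j) s := by
  refine (map_map_apply A _ _ f).trans ?_
  rw [extendMap_pointMap]
  rfl

/-- The map `(f, e) ↦ T(s)⁻¹ f(s) T(se)` for a `k`-rational point `s` of `Σ`. -/
def wreathRetraction (H : SubgroupFunctor G) (T : Sp B ⟶ G.sets) {Γ : GroupFunctor k}
    (σ : Γ ⟶ autOp B) (s : ∀ R : CommAlgCat.{u} k, B ⟶ R)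
    (hs : ∀ {R S : CommAlgCat.{u} k} (j : R ⟶ S), s R ≫ j = s S) :
    (wreath H.toFunctor σ).sets ⟶ G.sets where
  app R := TypeCat.ofHom fun w : (wreath H.toFunctor σ).obj R =>
    ((pointOf T (s R))⁻¹ * H.incl.app R (eval (wreathLeft w) (𝟙 R) (s R)) *
      pointOf T (act (𝟙 R) (s R) (σ.app R (wreathRight w))) : G.obj R)
  naturality R S j := by
    ext w
    change (pointOf T (s S))⁻¹ *
        H.incl.app S (eval ((power H.toFunctor B).map j (wreathLeft w)) (𝟙 S) (s S)) *
        pointOf T (act (𝟙 S) (s S) (σ.app S (Γ.map j (wreathRight w)))) =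
      G.map j ((pointOf T (s R))⁻¹ * H.incl.app R (eval (wreathLeft w) (𝟙 R) (s R)) *
        pointOf T (act (𝟙 R) (s R) (σ.app R (wreathRight w))))
    rw [map_mul, map_mul, map_inv, ← pointOf_map, ← pointOf_map, act_comp, hs, ← incl_map,
      map_eval, hs, eval_map, app_map, act_map, Category.id_comp, Category.comp_id]

lemma wreathRetraction_toWreath (s : ∀ R : CommAlgCat.{u} k, B ⟶ R)
    (hs : ∀ {R S : CommAlgCat.{u} k} (j : R ⟶ S), s R ≫ j = s S) (g : G.obj R) :
    (wreathRetraction H T (image ρ).incl s hs).app R ((toWreath hmem).app R g) = g := by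
  change (pointOf T (s R))⁻¹ * H.incl.app R (eval (wreathCocycle hmem g) (𝟙 R) (s R)) *
        pointOf T (act (𝟙 R) (s R) (ρ.app R g)) = g
  rw [incl_eval_wreathCocycle, cocycle, G.map_id]
  simp [mul_assoc]

end cocycle

end Proalg
end

theorem theorem1p4 {k : Type u} [Field k]
    (G : Proalg.GroupFunctor k) (hG : Proalg.IsProalgebraic G)
    (H : Proalg.SubgroupFunctor G) (hH : H.IsClosed)
    (B : CommAlgCat.{u} k) [Module.Finite k B]
    (p : Proalg.cosetFunctor H ⟶ Proalg.Sp B) (hp : Proalg.IsCosetSpace H p)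
    (T : Proalg.Sp B ⟶ G.sets) (hT : T ≫ Proalg.toCoset H ≫ p = 𝟙 (Proalg.Sp B)) :
    (∃! ρ : G ⟶ Proalg.autOp B, Proalg.IsNaturalAction p ρ) ∧
    ∀ ρ : G ⟶ Proalg.autOp B, Proalg.IsNaturalAction p ρ →
      Proalg.IsZeroLocusOfKernel ρ (Proalg.image ρ) ∧
      Proalg.IsProalgebraic (Proalg.wreath H.toFunctor (Proalg.image ρ).incl) ∧
      ∃ φ : G ⟶ Proalg.wreath H.toFunctor (Proalg.image ρ).incl,
        Proalg.IsClosedEmbedding φ ∧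
        ∀ (R : CommAlgCat.{u} k) (g : G.obj R),
          (Proalg.image ρ).incl.app R (Proalg.wreathRight (φ.app R g)) = ρ.app R g ∧
          ∀ (S : CommAlgCat.{u} k) (j : R ⟶ S) (s : B ⟶ S),
            H.incl.app S (Proalg.eval (Proalg.wreathLeft (φ.app R g)) j s) =
              Proalg.pointOf T s * G.map j g *
                (Proalg.pointOf T (Proalg.act j s (ρ.app R g)))⁻¹ := by
  refine ⟨?_, fun ρ hρ => ?_⟩
  · obtain ⟨ρ, hρ⟩ := Proalg.exists_isNaturalAction hH hp hT
    exact ⟨ρ, hρ, fun ρ' hρ' => hρ'.unique hρ hT⟩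
  have hAut : Proalg.IsProalgebraic (Proalg.autOp B) := Proalg.autOp_isProalgebraic B
  have hImage := Proalg.isZeroLocusOfKernel_image hG hAut ρ
  have hWreath := Proalg.wreath_isProalgebraic (hH.isProalgebraic hG)
    (hImage.isClosed.isProalgebraic hAut) (Proalg.image ρ).incl
  have hmem : ∀ {R S : CommAlgCat.{u} k} (j : R ⟶ S) (s : B ⟶ S) (g : G.obj R),
      Proalg.cocycle T ρ j s g ∈ H.obj S := Proalg.cocycle_mem hH hp hT hρ
  refine ⟨hImage, hWreath, Proalg.toWreath hmem, ?_, fun R g =>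
    ⟨rfl, fun S j s => Proalg.incl_eval_wreathCocycle hmem g j s⟩⟩
  -- The rational point used for the retraction is the base coset `π(1)`, compatible with base
  -- change because group maps preserve `1`.
  refine Proalg.isClosedEmbedding_of_retraction hWreath _
    (Proalg.wreathRetraction H T _ (fun R => Proalg.proj p (1 : G.obj R)) fun j => ?_)
    fun R g => Proalg.wreathRetraction_toWreath hmem _ _ g
  rw [← Proalg.proj_map, map_one]
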